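/- Let $W$ be a finite Coxeter group with simple reflections $(s_i)_{i\in I}$ and Cartan matrix $(a_{ij})_{i,j\in I}$, that is, a real matrix with $a_{ii}=2$, $a_{ij}\le 0$ and $a_{ij}a_{ji}=4\cos^2(\pi/m(i,j))$ for $i\ne j$, and $a_{ij}=0\iff a_{ji}=0$. Let $W$ act on $\bigoplus_{i\in I}\mathbb{R}\alpha_i$ by $s_i(\alpha_j)=\alpha_j-a_{ij}\alpha_i$, and let $R=\{w(\alpha_i)\mid w\in W,\ i\in I\}$ be its set of roots. A root is positive if it is a combination of the simple roots $\alpha_i$ with non-negative coefficients. For $\alpha=w(\alpha_i)\in R$ put $s_\alpha=ws_iw^{-1}$, and let the projection $\pi_\alpha$ act on $W$ from the right by $$w.\pi_\alpha=\begin{cases} ws_\alpha & \text{if } w(\alpha) \text{ is positive},\\ w & \text{otherwise;}\end{cases}$$ extend it linearly to $\mathbb{C}W$, the complex vector space with basis $W$. In particular, $\pi_i:=\pi_{\alpha_i}$ satisfies $w.\pi_i=w$ if $i$ is a right descent of $w$, and $w.\pi_i=ws_i$ otherwise. The Hecke group algebra of $W$ is the smallest (unital) subalgebra of $\operatorname{End}(\mathbb{C}W)$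 that contains both the $0$-Hecke algebra of $W$ (generated by the operators $\pi_i$, $i\in I$) and the group algebra of $W$, each acting on $\mathbb{C}W$ by its right regular representation. Let $S\subseteq R$ be a set of roots such that the projections $\{\pi_\alpha\mid\alpha\in S\}$ act transitively on $W$, i.e. for all $u,v\in W$ some finite product of these projections maps $u$ to $v$. Then the Hecke group algebra of $W$ is generated as a unital algebra by $\{\pi_\alpha\mid\alpha\in S\}$: the unital subalgebra of $\operatorname{End}(\mathbb{C}W)$ generated by these operators is equal to the Hecke group algebra. -/

import Mathlib

noncomputable section

namespace HeckeGroup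

variable {B W : Type*} [Group W] {M : CoxeterMatrix B}

/-- `a` is a (generalized, real) Cartan matrix for the Coxeter group with Coxeter matrix `M`
(as usual in Mathlib, the entry `M i j = 0` stands for `m(i, j) = ∞`). -/
structure IsCartanMatrix (M : CoxeterMatrix B) (a : Matrix B B ℝ) : Prop where
  diag : ∀ i, a i i = 2
  nonpos : ∀ i j, i ≠ j → a i j ≤ 0
  zero_iff : ∀ i j, a i j = 0 ↔ a j i = 0
  mul_eq : ∀ i j, i ≠ j → M i j ≠ 0 → a i j * a j i = 4 * Real.cos (Real.pi / M i j) ^ 2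
  four_le : ∀ i j, i ≠ j → M i j = 0 → 4 ≤ a i j * a j i

/-- The simple root `α_i` in the root space `⨁ i, ℝ α_i`. -/
def simpleRoot (i : B) : B →₀ ℝ := Finsupp.single i 1

/-- The pairing `⟨x, β⟩` of a coweight `x`, given by its values `x i = ⟨x, α_i⟩` on the simple
roots, with an element `β` of the root space. -/
def pairing (x : B → ℝ) : Module.Dual ℝ (B →₀ ℝ) := Finsupp.linearCombination ℝ x

/-- The simple coroot `α_i^∨`: `⟨α_i^∨, α_j⟩ = a i j`. -/
def simpleCoroot (a : Matrix B B ℝ) (i : B) : Module.Dual ℝ (B →₀ ℝ) := pairing (a i)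

theorem simpleCoroot_simpleRoot (a : Matrix B B ℝ) (i j : B) :
    simpleCoroot a i (simpleRoot j) = a i j := by
  simp [simpleCoroot, pairing, simpleRoot]

theorem simpleCoroot_self {a : Matrix B B ℝ} (ha : IsCartanMatrix M a) (i : B) :
    simpleCoroot a i (simpleRoot i) = 2 := by
  rw [simpleCoroot_simpleRoot, ha.diag]

/-- The action `x ↦ x - ⟨α_i^∨, x⟩ α_i` of the simple reflection `s_i` on the root space. -/
def simpleReflection {a : Matrix B B ℝ} (ha : IsCartanMatrix M a) (i : B) :
    (B →₀ ℝ) ≃ₗ[ℝ] (B →₀ ℝ) :=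
  Module.reflection (simpleCoroot_self ha i)

open Polynomial Chebyshev in
theorem eval_S_eq_zero (m : ℕ) (hm : 3 ≤ m) (t : ℝ)
    (ht : t = 2 * Real.cos (2 * Real.pi / m)) :
    (S ℝ (((m : ℤ) - 2) / 2)).eval t *
        ((S ℝ (((m : ℤ) - 1) / 2)).eval t + (S ℝ (((m : ℤ) - 3) / 2)).eval t) = 0 ∧
    (S ℝ (((m : ℤ) - 1) / 2)).eval t *
        ((S ℝ ((m : ℤ) / 2)).eval t + (S ℝ (((m : ℤ) - 2) / 2)).eval t) = 0 := by
  have hm0 : (0 : ℝ) < m := by positivity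
  have hm3 : (3 : ℝ) ≤ m := by exact_mod_cast hm
  set th : ℝ := 2 * Real.pi / m with hth
  have hmth : (m : ℝ) * th = 2 * Real.pi := by rw [hth]; field_simp
  have hs : Real.sin th ≠ 0 := by
    apply ne_of_gt
    apply Real.sin_pos_of_pos_of_lt_pi
    · positivity
    · rw [hth, div_lt_iff₀ hm0]; nlinarith [Real.pi_pos]
  have key (k : ℤ) : (S ℝ k).eval t * Real.sin th = Real.sin ((k + 1) * th) := by
    rw [ht]; exact S_two_mul_real_cos th k
  rcases Nat.even_or_odd' m with ⟨k, rfl | rfl⟩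
  · have e1 : (((2 * k : ℕ) : ℤ) - 2) / 2 = (k : ℤ) - 1 := by omega
    have e2 : (((2 * k : ℕ) : ℤ) - 1) / 2 = (k : ℤ) - 1 := by omega
    have h0 : (S ℝ ((k : ℤ) - 1)).eval t = 0 := by
      have h := key ((k : ℤ) - 1)
      have hk : (((k : ℤ) - 1 : ℤ) + 1 : ℝ) * th = Real.pi := by
        push_cast at hmth ⊢; linarith
      rw [hk, Real.sin_pi] at h
      exact (mul_eq_zero.mp h).resolve_right hs
    rw [e1, e2, h0]; simp
  · have e1 : (((2 * k + 1 : ℕ) : ℤ) - 1) / 2 = (k : ℤ) := by omega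
    have e2 : (((2 * k + 1 : ℕ) : ℤ) - 3) / 2 = (k : ℤ) - 1 := by omega
    have e3 : (((2 * k + 1 : ℕ) : ℤ)) / 2 = (k : ℤ) := by omega
    have e4 : (((2 * k + 1 : ℕ) : ℤ) - 2) / 2 = (k : ℤ) - 1 := by omega
    have h0 : (S ℝ (k : ℤ)).eval t + (S ℝ ((k : ℤ) - 1)).eval t = 0 := by
      have h1 := key (k : ℤ)
      have h2 := key ((k : ℤ) - 1)
      have hk : (((k : ℤ) - 1 : ℤ) + 1 : ℝ) * th = 2 * Real.pi - ((k : ℤ) + 1 : ℝ) * th := by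
        push_cast at hmth ⊢; linarith
      rw [hk, Real.sin_two_pi_sub] at h2
      have : ((S ℝ (k : ℤ)).eval t + (S ℝ ((k : ℤ) - 1)).eval t) * Real.sin th = 0 := by
        rw [add_mul, h1, h2]; ring
      exact (mul_eq_zero.mp this).resolve_right hs
    rw [e1, e2, e3, e4, h0]; simp

/-- The simple reflections of the root space satisfy the Coxeter relations. -/
theorem isLiftable_simpleReflection {a : Matrix B B ℝ} (ha : IsCartanMatrix M a) :
    M.IsLiftable (simpleReflection ha) := by
  intro i j
  by_cases hij : i = j
  · subst hij
    rw [M.diagonal, pow_one]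
    ext1 x
    exact Module.involutive_reflection (simpleCoroot_self ha i) x
  by_cases h0 : M i j = 0
  · rw [h0, pow_zero]
  have h1 : M i j ≠ 1 := M.off_diagonal i j hij
  have hprod := ha.mul_eq i j hij h0
  apply LinearEquiv.toLinearMap_injective
  unfold simpleReflection
  rw [Module.reflection_mul_reflection_pow (simpleCoroot_self ha i) (simpleCoroot_self ha j)
    (M i j) (a i j * a j i - 2) (by rw [simpleCoroot_simpleRoot, simpleCoroot_simpleRoot])]
  by_cases h2 : M i j = 2
  · have hz : a i j * a j i = 0 := by rw [hprod, h2]; simp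
    have hz1 : a i j = 0 := by
      rcases mul_eq_zero.mp hz with h | h
      · exact h
      · exact (ha.zero_iff i j).mpr h
    have hz2 : a j i = 0 := (ha.zero_iff i j).mp hz1
    rw [h2]
    ext1 k
    have q1 : ((2 : ℕ) : ℤ) - 2 = 0 := by norm_num
    have q2 : (((2 : ℕ) : ℤ) - 1) / 2 = 0 := by norm_num
    have q3 : (((2 : ℕ) : ℤ) - 3) / 2 = -1 := by norm_num
    have q4 : ((2 : ℕ) : ℤ) / 2 = 1 := by norm_num
    rw [q1, q2, q3, q4]
    ext1
    simp [simpleCoroot_simpleRoot, hz1, hz2]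
    module
  · have h3 : 3 ≤ M i j := by omega
    have ht : a i j * a j i - 2 = 2 * Real.cos (2 * Real.pi / M i j) := by
      rw [hprod, mul_div_assoc, Real.cos_two_mul]; ring
    obtain ⟨e1, e2⟩ := eval_S_eq_zero (M i j) h3 _ ht
    rw [e1, e2]
    simp

variable (cs : CoxeterSystem M W) {a : Matrix B B ℝ} (ha : IsCartanMatrix M a)

/-- The geometric representation of `W` on the root space. -/
def geomRep : W →* ((B →₀ ℝ) ≃ₗ[ℝ] (B →₀ ℝ)) :=
  cs.lift ⟨simpleReflection ha, isLiftable_simpleReflection ha⟩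

theorem geomRep_simple_apply (i : B) (x : B →₀ ℝ) :
    geomRep cs ha (cs.simple i) x = x - simpleCoroot a i x • simpleRoot i := by
  rw [geomRep, cs.lift_apply_simple]
  exact Module.reflection_apply x (simpleCoroot_self ha i)

/-- The set of roots `{w(α_i) | w ∈ W, i ∈ I}`. -/
def roots : Set (B →₀ ℝ) := {β | ∃ (w : W) (i : B), geomRep cs ha w (simpleRoot i) = β}

theorem geomRep_mem_roots (w : W) (α : roots cs ha) :
    geomRep cs ha w (α : B →₀ ℝ) ∈ roots cs ha := by
  obtain ⟨β, u, i, rfl⟩ := α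
  exact ⟨w * u, i, by rw [map_mul]; rfl⟩

/-- `β` is positive: the fundamental chamber `{x | ∀ i, ⟨x, α_i⟩ > 0}` lies in the half-space
`{x | ⟨x, β⟩ > 0}`. -/
def IsPositive (β : B →₀ ℝ) : Prop := ∀ x : B → ℝ, (∀ i, 0 < x i) → 0 < pairing x β

/-- The reflection `s_α ∈ W` of a root `α = w(α_i)`, that is `w s_i w⁻¹`
(which does not depend on the choice of `w` and `i`). -/
def rootReflection (α : roots cs ha) : W :=
  α.2.choose * cs.simple α.2.choose_spec.choose * α.2.choose⁻¹

theorem rootReflection_spec (α : roots cs ha) :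
    ∃ (w : W) (i : B), geomRep cs ha w (simpleRoot i) = α ∧
      rootReflection cs ha α = w * cs.simple i * w⁻¹ :=
  ⟨_, _, α.2.choose_spec.choose_spec, rfl⟩

open scoped Classical in
/-- The right action `w ↦ w.π_α` on `W` of the projection onto the negative half-space of the
root `α`. The chamber `w⁻¹(C)` lies on the positive side of the hyperplane of `α` if and only if
`⟨x, w(α)⟩ = ⟨w⁻¹(x), α⟩ > 0` for all `x` in the fundamental chamber `C`; in this case
`w.π_α = w s_α`, otherwise `w.π_α = w`. -/
def proj (α : roots cs ha) : Function.End W := fun w =>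
  if IsPositive (geomRep cs ha w (α : B →₀ ℝ)) then w * rootReflection cs ha α else w

/-- The monoid generated by the projections `π_α`, `α ∈ S`, acts transitively on `W`. -/
def ProjActTransitively (S : Set (roots cs ha)) : Prop :=
  ∀ u v : W, ∃ f ∈ Submonoid.closure (proj cs ha '' S), f u = v

/-- The linear operator on `ℂW` that extends a map `f : W → W`. -/
def linearOp (f : W → W) : Module.End ℂ (W →₀ ℂ) := Finsupp.lmapDomain ℂ ℂ f

open scoped Classical in
/-- The right regular action of the generator `π_i` of the `0`-Hecke monoid: `w.π_i = w` if `i` is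
a right descent of `w`, and `w.π_i = w s_i` otherwise. -/
def zeroHeckeGen (i : B) : W → W := fun w =>
  if cs.IsRightDescent w i then w else w * cs.simple i

/-- The image of the `0`-Hecke algebra in `End(ℂW)` under the right regular representation. -/
def zeroHeckeAlgebra : Subalgebra ℂ (Module.End ℂ (W →₀ ℂ)) :=
  Algebra.adjoin ℂ (Set.range fun i : B => linearOp (zeroHeckeGen cs i))

variable (W) in
/-- The image of the group algebra `ℂ[W]` in `End(ℂW)` under the right regular representation. -/
def groupAlgebra : Subalgebra ℂ (Module.End ℂ (W →₀ ℂ)) :=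
  Algebra.adjoin ℂ (Set.range fun w : W => linearOp fun u => u * w)

/-- The Hecke group algebra: the smallest subalgebra of `End(ℂW)` that contains both the `0`-Hecke
algebra and the group algebra. -/
def heckeGroupAlgebra : Subalgebra ℂ (Module.End ℂ (W →₀ ℂ)) :=
  zeroHeckeAlgebra cs ⊔ groupAlgebra W

end HeckeGroup

end

namespace HeckeGroup

/-! Let `A` be the algebra generated by the `π_α`, `α ∈ S`. One inclusion is conjugation: each `π_α`
is some `π_i` conjugated by a group element. The content of the converse is that `A` contains `ℂW`.

Geometrically, `π_α` folds the chamber complex along the hyperplane of `α`: it does not increase the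
gallery distance `ℓ(u v⁻¹)`, and it strictly decreases it between opposite sides
(`length_fold_mul_inv_fold_add_le`). This rests on the fact that `w(α_i)` is positive exactly when
`i` is not a right descent of `w`, and on an exchange property (`simple_mul_eq_mul_simple`).

Let `J` be `stablePart`, the space of those `T` with `bT ∈ A` for all `b` in the algebra generated
by `A` and `ℂW`. If `1 ∉ J`, choose `T ∈ A \ J` whose support has the least sum of pairwise
distances. For `α ∈ S`, either `π_α T ∈ J` or the support lies on one side of `α`. With `π_α + s_α
π_α = 1 + s_α`, this puts `s_α T` in `A` as soon as `π_α` moves some element of the support.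
Following that element under the transitive action puts all translates of `T` in `A`. Then `J` plus
the span of the translates is stable and contained in `A`, hence in `J`, so `T ∈ J`, a contradiction
(`not_isMinimal`).

Finally, a sign character shows that each `s_i` is conjugate to some `s_α` with `α ∈ S`. Conjugating
`π_α` inside `A` then gives `π_i` or `1 + s_i - π_i`. -/

/-! ### Root coefficients in rank two. -/

/-- The coefficients of the roots of a dihedral subsystem: `dihedralCoeff p q` starts with `0, 1`
and satisfies a two-term recursion whose multiplier alternates between `p` and `q`. -/
def dihedralCoeff (p q : ℝ) : ℕ → ℝ
  | 0 => 0
  | 1 => 1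
  | n + 2 => (if Even n then p else q) * dihedralCoeff p q (n + 1) - dihedralCoeff p q n

/-- Rescaling one of the two simple roots by `p / t` makes the rank-two Cartan matrix symmetric,
with both multipliers equal to `t`. Only the even-indexed coefficients are affected. -/
theorem dihedralCoeff_eq {p q t : ℝ} (ht : t ≠ 0) (hpq : p * q = t ^ 2) {d : ℕ → ℝ}
    (h0 : d 0 = 0) (h1 : d 1 = 1) (hd : ∀ n, d (n + 2) = t * d (n + 1) - d n) (n : ℕ) :
    dihedralCoeff p q n = (if Even n then p / t else 1) * d n ∧
      dihedralCoeff p q (n + 1) = (if Even (n + 1) then p / t else 1) * d (n + 1) := by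
  induction n with
  | zero => simp [dihedralCoeff, h0, h1]
  | succ n ih =>
    refine ⟨ih.2, ?_⟩
    rw [dihedralCoeff, ih.1, ih.2, hd]
    rcases Nat.even_or_odd n with h | h
    · have h' : ¬ Even (n + 1) := by rw [Nat.even_add_one]; simpa using h
      have h'' : Even (n + 1 + 1) := by rw [Nat.even_add_one]; exact h'
      simp only [h, h', h'', if_true, if_false]
      field_simp
    · have h0 : ¬ Even n := Nat.not_even_iff_odd.2 h
      have h' : Even (n + 1) := by rw [Nat.even_add_one]; exact h0
      have h'' : ¬ Even (n + 1 + 1) := by rw [Nat.even_add_one]; simpa using h'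
      simp only [h0, h', h'', if_true, if_false]
      have : q * (p / t) = t := by field_simp; linarith
      rw [← mul_assoc, this]; ring

theorem dihedralCoeff_nonneg_of_sq {p q t : ℝ} (hp : 0 ≤ p) (ht : 0 < t) (hpq : p * q = t ^ 2)
    {d : ℕ → ℝ} (h0 : d 0 = 0) (h1 : d 1 = 1) (hd : ∀ n, d (n + 2) = t * d (n + 1) - d n)
    {n : ℕ} (hn : 0 ≤ d n) : 0 ≤ dihedralCoeff p q n := by
  rw [(dihedralCoeff_eq ht.ne' hpq h0 h1 hd n).1]
  split_ifs <;> positivity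

/-- The sequence `0, 1, t, t² - 1, …` of Chebyshev polynomials evaluated at `t`. -/
def chebyshevSeq (t : ℝ) : ℕ → ℝ
  | 0 => 0
  | 1 => 1
  | n + 2 => t * chebyshevSeq t (n + 1) - chebyshevSeq t n

theorem chebyshevSeq_nonneg {t : ℝ} (ht : 2 ≤ t) (n : ℕ) :
    0 ≤ chebyshevSeq t n ∧ chebyshevSeq t n ≤ chebyshevSeq t (n + 1) := by
  induction n with
  | zero => simp [chebyshevSeq]
  | succ n ih =>
    refine ⟨ih.1.trans ih.2, ?_⟩
    rw [chebyshevSeq]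
    nlinarith [ih.1, ih.2]

variable {B W : Type*} [Group W] {M : CoxeterMatrix B}

/-! ### Positive roots, descents and the exchange property. -/

section Positivity

/-- After symmetrization the coefficients are `sin (nθ) / sin θ` with `θ = π / m`, non-negative up
to `n = m`; for `m = ∞` the multiplier is at least `2` and the sequence increases. The case `m = 2`
is separate because `t = 0` rules out the rescaling. -/
theorem dihedralCoeff_nonneg {a : Matrix B B ℝ} (ha : IsCartanMatrix M a) {i j : B} (hij : i ≠ j)
    {n : ℕ} (hn : M i j = 0 ∨ n ≤ M i j) : 0 ≤ dihedralCoeff (-a j i) (-a i j) n := by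
  have hp : 0 ≤ -a j i := neg_nonneg.2 (ha.nonpos j i hij.symm)
  by_cases h0 : M i j = 0
  · have h4 := ha.four_le i j hij h0
    have ht : 2 ≤ Real.sqrt (a i j * a j i) := by
      rw [show (2 : ℝ) = Real.sqrt 4 by
        rw [show (4 : ℝ) = 2 ^ 2 by norm_num, Real.sqrt_sq (by norm_num)]]
      exact Real.sqrt_le_sqrt h4
    exact dihedralCoeff_nonneg_of_sq hp (by linarith)
      (by rw [Real.sq_sqrt (by linarith)]; ring) (d := chebyshevSeq _) rfl rfl (fun _ => rfl)
      (chebyshevSeq_nonneg ht n).1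
  have hn : n ≤ M i j := hn.resolve_left h0
  have h1 : M i j ≠ 1 := M.off_diagonal i j hij
  have hprod := ha.mul_eq i j hij h0
  by_cases h2 : M i j = 2
  · have hz : a i j * a j i = 0 := by rw [hprod, h2]; simp
    have hz2 : a j i = 0 := by
      rcases mul_eq_zero.mp hz with h | h
      · exact (ha.zero_iff i j).1 h
      · exact h
    rw [h2] at hn
    interval_cases n <;> simp [dihedralCoeff, hz2]
  · have h3 : (3 : ℝ) ≤ M i j := by
      have : 3 ≤ M i j := by omega
      exact_mod_cast this
    have hm0 : (0 : ℝ) < M i j := by linarith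
    set θ : ℝ := Real.pi / M i j with hθ
    have hθ0 : 0 < θ := by positivity
    have hθ1 : θ < Real.pi / 2 :=
      div_lt_div_of_pos_left Real.pi_pos (by norm_num) (by linarith)
    have hs : 0 < Real.sin θ := Real.sin_pos_of_pos_of_lt_pi hθ0 (by linarith)
    have hc : 0 < Real.cos θ := Real.cos_pos_of_mem_Ioo ⟨by linarith, hθ1⟩
    refine dihedralCoeff_nonneg_of_sq hp (t := 2 * Real.cos θ) (by linarith)
      (by rw [mul_pow]; linarith) (d := fun n => Real.sin (n * θ) / Real.sin θ) (by simp)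
      (by simp [hs.ne']) (fun n => ?_) ?_
    · have e1 : ((n + 2 : ℕ) : ℝ) * θ = (n + 1 : ℕ) * θ + θ := by push_cast; ring
      have e2 : (n : ℝ) * θ = (n + 1 : ℕ) * θ - θ := by push_cast; ring
      rw [e1, e2, Real.sin_add, Real.sin_sub]
      field_simp
      ring
    · apply div_nonneg _ hs.le
      apply Real.sin_nonneg_of_nonneg_of_le_pi (by positivity)
      have : (n : ℝ) ≤ M i j := by exact_mod_cast hn
      calc (n : ℝ) * θ ≤ M i j * θ := by gcongr
        _ = Real.pi := by rw [hθ]; field_simp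

variable (cs : CoxeterSystem M W) {a : Matrix B B ℝ} (ha : IsCartanMatrix M a)

theorem geomRep_mul_apply (v w : W) (x : B →₀ ℝ) :
    geomRep cs ha (v * w) x = geomRep cs ha v (geomRep cs ha w x) := by
  rw [map_mul]; rfl

theorem geomRep_simple_simpleRoot (i j : B) :
    geomRep cs ha (cs.simple i) (simpleRoot j) = simpleRoot j - a i j • simpleRoot i := by
  rw [geomRep_simple_apply, simpleCoroot_simpleRoot]

theorem geomRep_simple_simpleRoot_self (i : B) :
    geomRep cs ha (cs.simple i) (simpleRoot i) = -simpleRoot i := by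
  rw [geomRep_simple_simpleRoot, ha.diag]; module

-- Each further letter changes only one of the two coefficients, through one step of the recursion;
-- the parity of `k` tells which.
open CoxeterSystem in
theorem geomRep_alternatingWord (i j : B) (k : ℕ) :
    geomRep cs ha (cs.wordProd (alternatingWord i j k)) (simpleRoot i) =
      if Even k then
        dihedralCoeff (-a j i) (-a i j) (k + 1) • simpleRoot i +
          dihedralCoeff (-a j i) (-a i j) k • simpleRoot j
      else
        dihedralCoeff (-a j i) (-a i j) k • simpleRoot i +
          dihedralCoeff (-a j i) (-a i j) (k + 1) • simpleRoot j := by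
  induction k with
  | zero => simp [alternatingWord, dihedralCoeff]
  | succ k ih =>
    rw [alternatingWord_succ', cs.wordProd_cons, geomRep_mul_apply, ih]
    rcases Nat.even_or_odd k with h | h
    · have h' : ¬ Even (k + 1) := by rw [Nat.even_add_one]; simpa using h
      simp only [h, h', if_true, if_false, map_add, map_smul, geomRep_simple_simpleRoot,
        ha.diag]
      rw [show dihedralCoeff (-a j i) (-a i j) (k + 1 + 1) = -a j i *
        dihedralCoeff (-a j i) (-a i j) (k + 1) - dihedralCoeff (-a j i) (-a i j) k by
          rw [dihedralCoeff, if_pos h]]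
      module
    · have h0 : ¬ Even k := Nat.not_even_iff_odd.2 h
      have h' : Even (k + 1) := by rw [Nat.even_add_one]; exact h0
      simp only [h0, h', if_true, if_false, map_add, map_smul, geomRep_simple_simpleRoot,
        ha.diag]
      rw [show dihedralCoeff (-a j i) (-a i j) (k + 1 + 1) = -a i j *
        dihedralCoeff (-a j i) (-a i j) (k + 1) - dihedralCoeff (-a j i) (-a i j) k by
          rw [dihedralCoeff, if_neg h0]]
      module

open CoxeterSystem in
/-- Factorization of `w` along the dihedral parabolic subgroup generated by `i` and a right
descent `j` of `w`. -/
theorem exists_eq_mul_alternatingWord {w : W} {i j : B} (hj : cs.IsRightDescent w j) :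
    ∃ (v : W) (k : ℕ), 0 < k ∧ w = v * cs.wordProd (alternatingWord i j k) ∧
      cs.length w = cs.length v + k ∧ ¬ cs.IsRightDescent v i ∧ ¬ cs.IsRightDescent v j := by
  classical
  let p : ℕ → Prop := fun k => ∃ v : W, w = v * cs.wordProd (alternatingWord i j k) ∧
      cs.length w = cs.length v + k
  have hp1 : p 1 := by
    refine ⟨w * cs.simple j, by simp [alternatingWord], ?_⟩
    rw [cs.isRightDescent_iff] at hj
    omega
  have hle : ∀ k, p k → k ≤ cs.length w := fun k ⟨v, _, h⟩ => by omega
  obtain ⟨v, hv, hl⟩ := Nat.findGreatest_spec (hle 1 hp1) hp1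
  set k := Nat.findGreatest p (cs.length w) with hk
  have hk1 : 1 ≤ k := Nat.le_findGreatest (hle 1 hp1) hp1
  -- Maximality of `k` excludes the letter that would continue the alternation; additivity of
  -- lengths excludes the other one, which would cancel the first letter of the word.
  have hmax : ¬ p (k + 1) := fun h => by
    have := Nat.le_findGreatest (hle _ h) h
    omega
  have hnext : ¬ cs.IsRightDescent v (if Even k then j else i) := by
    intro h
    apply hmax
    refine ⟨v * cs.simple (if Even k then j else i), ?_, ?_⟩
    · rw [alternatingWord_succ', cs.wordProd_cons, ← mul_assoc,
        cs.simple_mul_simple_cancel_right, ← hv]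
    · rw [cs.isRightDescent_iff] at h
      omega
  have hprev : ¬ cs.IsRightDescent v (if Even k then i else j) := by
    intro h
    obtain ⟨n, hn⟩ : ∃ n, k = n + 1 := ⟨k - 1, by omega⟩
    have hif : (if Even k then i else j) = if Even n then j else i := by
      rw [hn]; simp only [Nat.even_add_one]; split_ifs <;> rfl
    rw [hif] at h
    rw [hn, alternatingWord_succ', cs.wordProd_cons, ← mul_assoc] at hv
    have h1 := cs.length_mul_le (v * cs.simple (if Even n then j else i))
      (cs.wordProd (alternatingWord i j n))
    rw [← hv] at h1
    have h2 := cs.length_wordProd_le (alternatingWord i j n)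
    rw [length_alternatingWord] at h2
    rw [cs.isRightDescent_iff] at h
    omega
  refine ⟨v, k, hk1, hv, hl, ?_, ?_⟩
  · split_ifs at hnext hprev <;> assumption
  · split_ifs at hnext hprev <;> assumption

open CoxeterSystem in
/-- If `w s_i` is longer than `w`, then `w(α_i)` has non-negative coefficients. -/
theorem geomRep_simpleRoot_nonneg {w : W} {i : B} (hi : ¬ cs.IsRightDescent w i) :
    0 ≤ geomRep cs ha w (simpleRoot i) := by
  induction hn : cs.length w using Nat.strong_induction_on generalizing w i with
  | _ n ih =>
  have hsimple (k : B) : (0 : B →₀ ℝ) ≤ simpleRoot k := by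
    intro l
    classical
    simp only [simpleRoot, Finsupp.single_apply, Finsupp.coe_zero, Pi.zero_apply]
    split_ifs <;> norm_num
  by_cases hw : w = 1
  · subst hw
    simpa using hsimple i
  obtain ⟨j, hj⟩ := cs.exists_rightDescent_of_ne_one hw
  have hij : i ≠ j := by rintro rfl; exact hi hj
  obtain ⟨v, k, hk, hv, hl, hvi, hvj⟩ := exists_eq_mul_alternatingWord cs (i := i) hj
  have h1 := ih _ (by omega) hvi rfl
  have h2 := ih _ (by omega) hvj rfl
  -- Since `i` is an ascent of `w`, appending it keeps the alternating word reduced. This forces `k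
  -- + 1 ≤ m(i, j)`, the range in which the rank-two coefficients are non-negative.
  have hred : cs.IsReduced (alternatingWord j i (k + 1)) := by
    rw [cs.not_isRightDescent_iff] at hi
    have e : w * cs.simple i = v * cs.wordProd (alternatingWord j i (k + 1)) := by
      rw [alternatingWord_succ, cs.wordProd_concat, ← mul_assoc, ← hv]
    have h3 := cs.length_mul_le v (cs.wordProd (alternatingWord j i (k + 1)))
    have h4 := cs.length_wordProd_le (alternatingWord j i (k + 1))
    rw [← e] at h3
    unfold CoxeterSystem.IsReduced
    rw [length_alternatingWord] at h4 ⊢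
    omega
  have hM : M i j = 0 ∨ k + 1 ≤ M i j := by
    by_contra! h
    refine cs.not_isReduced_alternatingWord j i (m := k + 1) ?_ ?_ hred
    · rw [M.symmetric]; exact h.1
    · rw [M.symmetric]; exact h.2
  have c1 := dihedralCoeff_nonneg ha hij hM
  have c2 := dihedralCoeff_nonneg ha hij (n := k) (hM.imp id (by omega))
  rw [hv, geomRep_mul_apply, geomRep_alternatingWord]
  split_ifs <;> rw [map_add, map_smul, map_smul] <;>
    exact add_nonneg (smul_nonneg ‹_› ‹_›) (smul_nonneg ‹_› ‹_›)

theorem isPositive_of_nonneg {β : B →₀ ℝ} (h : 0 ≤ β) (h0 : β ≠ 0) : IsPositive β := by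
  intro x hx
  rw [pairing, Finsupp.linearCombination_apply]
  refine Finsupp.sum_pos (fun i hi => ?_) h0
  exact mul_pos (lt_of_le_of_ne (h i) (Finsupp.mem_support_iff.1 hi).symm) (hx i)

theorem geomRep_simpleRoot_ne_zero (w : W) (i : B) : geomRep cs ha w (simpleRoot i) ≠ 0 := by
  rw [Ne, LinearEquiv.map_eq_zero_iff]
  simp [simpleRoot]

theorem geomRep_simpleRoot_nonpos {w : W} {i : B} (hi : cs.IsRightDescent w i) :
    geomRep cs ha w (simpleRoot i) ≤ 0 := by
  have h := geomRep_simpleRoot_nonneg cs ha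
    (cs.isRightDescent_iff_not_isRightDescent_mul.1 hi)
  rw [geomRep_mul_apply, geomRep_simple_simpleRoot_self, map_neg] at h
  exact neg_nonneg.1 h

/-- `w(α_i)` is positive if and only if `i` is not a right descent of `w`. -/
theorem isPositive_geomRep_simpleRoot_iff (w : W) (i : B) :
    IsPositive (geomRep cs ha w (simpleRoot i)) ↔ ¬ cs.IsRightDescent w i := by
  constructor
  · intro h hi
    have h1 := isPositive_of_nonneg (neg_nonneg.2 (geomRep_simpleRoot_nonpos cs ha hi))
      (neg_ne_zero.2 (geomRep_simpleRoot_ne_zero cs ha w i)) (fun _ => 1) (by simp)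
    have h2 := h (fun _ => 1) (by simp)
    rw [map_neg] at h1
    linarith
  · intro h
    exact isPositive_of_nonneg (geomRep_simpleRoot_nonneg cs ha h)
      (geomRep_simpleRoot_ne_zero cs ha w i)

/-- The geometric representation is faithful. -/
theorem eq_one_of_geomRep_simpleRoot {w : W}
    (h : ∀ i, geomRep cs ha w (simpleRoot i) = simpleRoot i) : w = 1 := by
  by_contra hw
  obtain ⟨i, hi⟩ := cs.exists_rightDescent_of_ne_one hw
  refine (isPositive_geomRep_simpleRoot_iff cs ha w i).1 ?_ hi
  rw [h i]
  have := (isPositive_geomRep_simpleRoot_iff cs ha 1 i).2 (cs.not_isRightDescent_one i)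
  simpa using this

/-- Exchange: left multiplication by `s_j` changes the side of `w` with respect to `i` only if
it agrees with right multiplication by `s_i`. -/
theorem simple_mul_eq_mul_simple [Finite W] (cs : CoxeterSystem M W) {a : Matrix B B ℝ}
    (ha : IsCartanMatrix M a) {w : W} {i j : B} (h1 : cs.IsRightDescent w i)
    (h2 : ¬ cs.IsRightDescent (cs.simple j * w) i) : cs.simple j * w = w * cs.simple i := by
  have hb := geomRep_simpleRoot_nonpos cs ha h1
  have hc := geomRep_simpleRoot_nonneg cs ha h2
  have hb0 := geomRep_simpleRoot_ne_zero cs ha w i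
  rw [geomRep_mul_apply, geomRep_simple_apply] at hc
  -- `s_j` changes only the `α_j`-coefficient, so every other coefficient of `w(α_i)` is both
  -- non-positive and non-negative. The factor need not be `-1`, as the Cartan matrix need not be
  -- symmetric.
  have hβ : geomRep cs ha w (simpleRoot i) = geomRep cs ha w (simpleRoot i) j • simpleRoot j := by
    ext k
    by_cases hk : k = j
    · subst hk; simp [simpleRoot]
    · have e1 := hc k
      have e2 := hb k
      simp only [Finsupp.coe_zero, Pi.zero_apply, Finsupp.coe_sub, Finsupp.coe_smul, Pi.sub_apply,
        Pi.smul_apply, simpleRoot, Finsupp.single_eq_of_ne hk, sub_zero,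
        smul_eq_mul, mul_zero] at e1 e2 ⊢
      linarith
  set c := geomRep cs ha w (simpleRoot i) j with hcdef
  have hc0 : c ≠ 0 := by
    intro h0
    rw [h0, zero_smul] at hβ
    exact hb0 hβ
  have hinv : geomRep cs ha w⁻¹ (simpleRoot j) = c⁻¹ • simpleRoot i := by
    have : geomRep cs ha w⁻¹ (geomRep cs ha w (simpleRoot i)) = simpleRoot i := by
      rw [← geomRep_mul_apply]; simp
    rw [hβ, map_smul] at this
    rw [← this, smul_smul, inv_mul_cancel₀ hc0, one_smul]
  -- `n` is a transvection along `α_i` that fixes `α_i`. Having finite order, it acts trivially, and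
  -- faithfulness gives `n = 1`.
  set n := w⁻¹ * cs.simple j * w * cs.simple i with hn
  let l : (B →₀ ℝ) → ℝ := fun x => -simpleCoroot a i x -
    simpleCoroot a j (geomRep cs ha w (geomRep cs ha (cs.simple i) x)) * c⁻¹
  have hl (x : B →₀ ℝ) : geomRep cs ha n x = x + l x • simpleRoot i := by
    rw [hn, geomRep_mul_apply, geomRep_mul_apply, geomRep_mul_apply, geomRep_simple_apply cs ha j,
      map_sub, map_smul, hinv, ← geomRep_mul_apply cs ha w⁻¹ w]
    simp only [inv_mul_cancel, map_one, LinearEquiv.coe_one, id_eq, l]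
    rw [geomRep_simple_apply]
    module
  have hfix : geomRep cs ha n (simpleRoot i) = simpleRoot i := by
    rw [hn, geomRep_mul_apply, geomRep_mul_apply, geomRep_mul_apply, geomRep_simple_simpleRoot_self,
      map_neg, hβ, map_neg, map_smul, geomRep_simple_simpleRoot_self, map_neg, map_smul, map_neg,
      hinv, smul_neg, neg_neg, smul_smul, mul_inv_cancel₀ hc0, one_smul]
  have hpow (k : ℕ) (x : B →₀ ℝ) : geomRep cs ha (n ^ k) x = x + (k * l x) • simpleRoot i := by
    induction k with
    | zero => simp
    | succ k ih =>
      rw [pow_succ', geomRep_mul_apply, ih, map_add, map_smul, hfix, hl]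
      push_cast
      module
  have hn1 : n = 1 := by
    apply eq_one_of_geomRep_simpleRoot cs ha
    intro k
    have h := hpow (orderOf n) (simpleRoot k)
    rw [pow_orderOf_eq_one] at h
    have h3 : ((orderOf n : ℝ) * l (simpleRoot k)) • simpleRoot i = (0 : B →₀ ℝ) := by
      simpa using h
    have h4 : simpleRoot i ≠ (0 : B →₀ ℝ) := by simp [simpleRoot]
    have h5 : (orderOf n : ℝ) ≠ 0 := by exact_mod_cast (orderOf_pos n).ne'
    have h6 : l (simpleRoot k) = 0 :=
      (mul_eq_zero.1 ((smul_eq_zero.1 h3).resolve_right h4)).resolve_left h5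
    rw [hl, h6, zero_smul, add_zero]
  have h7 : w⁻¹ * (cs.simple j * w) = cs.simple i := by
    rw [← cs.inv_simple i, eq_inv_iff_mul_eq_one, ← hn1, hn]; group
  rw [← h7]; group

end Positivity

/-! ### Projections as foldings, and gallery distance. -/

section Projections

variable (cs : CoxeterSystem M W) {a : Matrix B B ℝ} (ha : IsCartanMatrix M a)

/-- This reduces sides of a root hyperplane to right descents; from here on the positivity of roots
enters only through it. -/
theorem exists_rootReflection_eq (α : roots cs ha) :
    ∃ (v : W) (i : B), rootReflection cs ha α = v * cs.simple i * v⁻¹ ∧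
      ∀ u, IsPositive (geomRep cs ha u (α : B →₀ ℝ)) ↔ ¬ cs.IsRightDescent (u * v) i := by
  obtain ⟨v, i, h1, h2⟩ := rootReflection_spec cs ha α
  refine ⟨v, i, h2, fun u => ?_⟩
  rw [← h1, ← geomRep_mul_apply, isPositive_geomRep_simpleRoot_iff]

theorem rootReflection_mul_self (α : roots cs ha) :
    rootReflection cs ha α * rootReflection cs ha α = 1 := by
  obtain ⟨v, i, h, -⟩ := exists_rootReflection_eq cs ha α
  exact CoxeterSystem.IsReflection.mul_self ⟨v, i, h⟩

theorem isRightDescent_simple_mul_iff [Finite W] (cs : CoxeterSystem M W) {a : Matrix B B ℝ}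
    (ha : IsCartanMatrix M a) (u : W) (i j : B) :
    cs.IsRightDescent (cs.simple j * u) i ↔
      (cs.IsRightDescent u i ↔ cs.simple j * u ≠ u * cs.simple i) := by
  by_cases h : cs.simple j * u = u * cs.simple i
  · have := cs.isRightDescent_iff_not_isRightDescent_mul (w := u) (i := i)
    rw [h]
    tauto
  · simp only [ne_eq, h, not_false_eq_true, iff_true]
    by_contra h'
    by_cases h1 : cs.IsRightDescent u i
    · exact h (simple_mul_eq_mul_simple cs ha h1 (by tauto))
    · have h2 := simple_mul_eq_mul_simple cs ha (w := cs.simple j * u) (i := i) (j := j)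
        (by tauto) (by rwa [cs.simple_mul_simple_cancel_left])
      rw [cs.simple_mul_simple_cancel_left] at h2
      apply h
      rw [h2, cs.simple_mul_simple_cancel_right, ← h2]

theorem simple_mul_eq_of_not_iff [Finite W] (α : roots cs ha) {u : W} {j : B}
    (h : ¬ (IsPositive (geomRep cs ha (cs.simple j * u) (α : B →₀ ℝ)) ↔
      IsPositive (geomRep cs ha u (α : B →₀ ℝ)))) :
    cs.simple j * u = u * rootReflection cs ha α := by
  obtain ⟨v, i, ht, h'⟩ := exists_rootReflection_eq cs ha α
  rw [h', h', mul_assoc, isRightDescent_simple_mul_iff cs ha] at h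
  have : cs.simple j * (u * v) = u * v * cs.simple i := by tauto
  rw [ht, eq_comm, ← mul_assoc, ← mul_assoc, ← this]
  group

/-- The projection `π_α` as a plain function. -/
noncomputable def fold (α : roots cs ha) : W → W := proj cs ha α

theorem fold_of_isPositive {α : roots cs ha} {u : W}
    (h : IsPositive (geomRep cs ha u (α : B →₀ ℝ))) :
    fold cs ha α u = u * rootReflection cs ha α := if_pos h

theorem fold_of_not_isPositive {α : roots cs ha} {u : W}
    (h : ¬ IsPositive (geomRep cs ha u (α : B →₀ ℝ))) : fold cs ha α u = u := if_neg h

/-- The projections do not increase the gallery distance `ℓ(u v⁻¹)`, and they decrease it for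
elements on different sides. -/
theorem length_fold_mul_inv_fold_add_le [Finite W] (α : roots cs ha) (ω : List B) (v : W) :
    open scoped Classical in
    cs.length (fold cs ha α (cs.wordProd ω * v) * (fold cs ha α v)⁻¹) +
      (if IsPositive (geomRep cs ha (cs.wordProd ω * v) (α : B →₀ ℝ)) ↔
        IsPositive (geomRep cs ha v (α : B →₀ ℝ)) then 0 else 1) ≤ ω.length := by
  induction ω with
  | nil => simp
  | cons j ω ih =>
    rw [cs.wordProd_cons, mul_assoc, List.length_cons]
    set u := cs.wordProd ω * v
    by_cases h : IsPositive (geomRep cs ha (cs.simple j * u) (α : B →₀ ℝ)) ↔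
        IsPositive (geomRep cs ha u (α : B →₀ ℝ))
    -- A step that stays on one side commutes with the fold.
    · have e : fold cs ha α (cs.simple j * u) = cs.simple j * fold cs ha α u := by
        by_cases h1 : IsPositive (geomRep cs ha u (α : B →₀ ℝ))
        · rw [fold_of_isPositive cs ha h1, fold_of_isPositive cs ha (h.2 h1), mul_assoc]
        · rw [fold_of_not_isPositive cs ha h1, fold_of_not_isPositive cs ha (by tauto)]
      have h2 := cs.length_mul_le (cs.simple j) (fold cs ha α u * (fold cs ha α v)⁻¹)
      rw [cs.length_simple] at h2
      rw [e, mul_assoc]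
      split_ifs at ih ⊢ <;> first | omega | tauto
    -- A step across the wall is the reflection itself, so its two ends are folded together and one
    -- step of the gallery is saved.
    · have e : fold cs ha α (cs.simple j * u) = fold cs ha α u := by
        have e' := simple_mul_eq_of_not_iff cs ha α h
        by_cases h1 : IsPositive (geomRep cs ha u (α : B →₀ ℝ))
        · rw [fold_of_isPositive cs ha h1, fold_of_not_isPositive cs ha (by tauto), e']
        · rw [fold_of_not_isPositive cs ha h1, fold_of_isPositive cs ha (by tauto), e', mul_assoc,
            rootReflection_mul_self, mul_one]
      rw [e]
      split_ifs at ih ⊢ <;> omega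

theorem length_fold_mul_inv_fold_le [Finite W] (α : roots cs ha) (u v : W) :
    cs.length (fold cs ha α u * (fold cs ha α v)⁻¹) ≤ cs.length (u * v⁻¹) := by
  obtain ⟨ω, hω, h⟩ := cs.exists_isReduced (u * v⁻¹)
  have h1 := length_fold_mul_inv_fold_add_le cs ha α ω v
  rw [← hω.eq, ← h, inv_mul_cancel_right] at h1
  omega

theorem length_fold_mul_inv_fold_lt [Finite W] (α : roots cs ha) {u v : W}
    (hu : IsPositive (geomRep cs ha u (α : B →₀ ℝ)))
    (hv : ¬ IsPositive (geomRep cs ha v (α : B →₀ ℝ))) :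
    cs.length (fold cs ha α u * (fold cs ha α v)⁻¹) < cs.length (u * v⁻¹) := by
  obtain ⟨ω, hω, h⟩ := cs.exists_isReduced (u * v⁻¹)
  have h1 := length_fold_mul_inv_fold_add_le cs ha α ω v
  rw [← hω.eq, ← h, inv_mul_cancel_right, if_neg (by tauto)] at h1
  omega

/-- The sum of the pairwise gallery distances in a finite set. -/
noncomputable def spread (s : Finset W) : ℕ := ∑ p ∈ s ×ˢ s, cs.length (p.1 * p.2⁻¹)

theorem spread_mono {s t : Finset W} (h : s ⊆ t) : spread cs s ≤ spread cs t :=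
  Finset.sum_le_sum_of_subset (Finset.product_subset_product h h)

theorem spread_image_le [DecidableEq W] (f : W → W) (s : Finset W) :
    spread cs (s.image f) ≤ ∑ p ∈ s ×ˢ s, cs.length (f p.1 * (f p.2)⁻¹) := by
  rw [spread, ← Finset.prodMap_image_product]
  exact Finset.sum_image_le_of_nonneg (g := Prod.map f f)
    (f := fun p : W × W => cs.length (p.1 * p.2⁻¹)) (fun _ _ => Nat.zero_le _)

theorem spread_image_fold_lt [Finite W] [DecidableEq W] (α : roots cs ha) {s : Finset W} {u v : W}
    (hus : u ∈ s) (hvs : v ∈ s) (hu : IsPositive (geomRep cs ha u (α : B →₀ ℝ)))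
    (hv : ¬ IsPositive (geomRep cs ha v (α : B →₀ ℝ))) :
    spread cs (s.image (fold cs ha α)) < spread cs s :=
  (spread_image_le cs _ s).trans_lt <| Finset.sum_lt_sum
    (fun _ _ => length_fold_mul_inv_fold_le cs ha α _ _)
    ⟨(u, v), Finset.mk_mem_product hus hvs, length_fold_mul_inv_fold_lt cs ha α hu hv⟩

theorem spread_image_mul_right_le [DecidableEq W] (s : Finset W) (w : W) :
    spread cs (s.image (· * w)) ≤ spread cs s :=
  (spread_image_le cs _ s).trans <| Finset.sum_le_sum fun p _ => le_of_eq <| by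
    congr 1; group

end Projections

/-! ### Linear operators on `ℂW` and their supports. -/

section Operators

theorem linearOp_mul {W : Type*} (f g : W → W) : linearOp f * linearOp g = linearOp (f ∘ g) := by
  ext x : 2
  simp [linearOp]

theorem linearOp_single {W : Type*} (f : W → W) (u : W) (c : ℂ) :
    linearOp f (Finsupp.single u c) = Finsupp.single (f u) c := by
  simp [linearOp]

theorem linearOp_id {W : Type*} : linearOp (fun u : W => u) = 1 := by
  ext x : 2
  simp [linearOp_single]

theorem linearOp_mul_right_mul (v w : W) :
    linearOp (fun u : W => u * w) * linearOp (fun u => u * v) = linearOp fun u => u * (v * w) := by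
  rw [linearOp_mul]
  congr 1
  ext u
  simp [mul_assoc]

/-- On a basis element `u`, the two terms on the left are `u` and `u s_α` in some order. -/
theorem linearOp_fold_add (cs : CoxeterSystem M W) {a : Matrix B B ℝ} (ha : IsCartanMatrix M a)
    (α : roots cs ha) :
    linearOp (fold cs ha α) +
        linearOp (fun u => u * rootReflection cs ha α) * linearOp (fold cs ha α) =
      1 + linearOp fun u => u * rootReflection cs ha α := by
  rw [linearOp_mul]
  ext u : 2
  simp only [LinearMap.coe_comp, Function.comp_apply, Finsupp.lsingle_apply, LinearMap.add_apply,
    linearOp_single, Module.End.one_apply]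
  by_cases h : IsPositive (geomRep cs ha u (α : B →₀ ℝ))
  · rw [fold_of_isPositive cs ha h, mul_assoc, rootReflection_mul_self, mul_one, add_comm]
  · rw [fold_of_not_isPositive cs ha h]

variable [Finite W]

/-- The set of basis elements that occur in the image of an operator. -/
noncomputable def opSupport (T : Module.End ℂ (W →₀ ℂ)) : Finset W :=
  (Set.toFinite {v | ∃ x, T x v ≠ 0}).toFinset

theorem mem_opSupport {W : Type*} [Finite W] {T : Module.End ℂ (W →₀ ℂ)} {v : W} :
    v ∈ opSupport T ↔ ∃ x, T x v ≠ 0 := by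
  simp [opSupport]

theorem opSupport_nonempty {W : Type*} [Finite W] {T : Module.End ℂ (W →₀ ℂ)} (hT : T ≠ 0) :
    (opSupport T).Nonempty := by
  by_contra h
  apply hT
  ext x v
  by_contra h'
  exact h ⟨v, mem_opSupport.2 ⟨_, h'⟩⟩

theorem opSupport_linearOp_mul {W : Type*} [Finite W] [DecidableEq W] (f : W → W)
    (T : Module.End ℂ (W →₀ ℂ)) : opSupport (linearOp f * T) ⊆ (opSupport T).image f := by
  intro v hv
  obtain ⟨x, hx⟩ := mem_opSupport.1 hv
  obtain ⟨u, hu, rfl⟩ := Finset.mem_image.1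
    (Finsupp.mapDomain_support (Finsupp.mem_support_iff.2 hx))
  exact Finset.mem_image_of_mem f (mem_opSupport.2 ⟨x, Finsupp.mem_support_iff.1 hu⟩)

theorem mul_mem_opSupport {T : Module.End ℂ (W →₀ ℂ)} {v : W} (hv : v ∈ opSupport T) (w : W) :
    v * w ∈ opSupport (linearOp (fun u => u * w) * T) := by
  obtain ⟨x, hx⟩ := mem_opSupport.1 hv
  refine mem_opSupport.2 ⟨x, ?_⟩
  have : (linearOp (fun u => u * w) * T) x (v * w) = T x v :=
    Finsupp.mapDomain_apply (mul_left_injective w) (T x) v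
  rwa [this]

theorem linearOp_mul_congr {W : Type*} [Finite W] {f g : W → W} {T : Module.End ℂ (W →₀ ℂ)}
    (h : ∀ u ∈ opSupport T, f u = g u) : linearOp f * T = linearOp g * T := by
  ext1 x
  refine LinearMap.ext fun c => ?_
  exact Finsupp.mapDomain_congr fun u hu =>
    h u (mem_opSupport.2 ⟨_, Finsupp.mem_support_iff.1 hu⟩)

end Operators

/-! ### The group algebra lies in the algebra of projections. -/

section Generation

theorem mem_of_add_mem {W : Type*} {A : Subalgebra ℂ (Module.End ℂ (W →₀ ℂ))}
    {x y : Module.End ℂ (W →₀ ℂ)} (hx : x ∈ A) (h : x + y ∈ A) : y ∈ A := by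
  have e : y = x + y + (-1 : ℂ) • x := by
    ext : 3
    simp
  rw [e]
  exact add_mem h (A.smul_mem hx _)

variable (cs : CoxeterSystem M W) {a : Matrix B B ℝ} (ha : IsCartanMatrix M a)
  (S : Set (roots cs ha))

/-- The algebra generated by the projections `π_α`, `α ∈ S`. -/
noncomputable def projAlgebra : Subalgebra ℂ (Module.End ℂ (W →₀ ℂ)) :=
  Algebra.adjoin ℂ ((fun α => linearOp (proj cs ha α)) '' S)

variable {cs ha S}

theorem linearOp_fold_mem {α : roots cs ha} (hα : α ∈ S) :
    linearOp (fold cs ha α) ∈ projAlgebra cs ha S :=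
  Algebra.subset_adjoin ⟨α, hα, rfl⟩

theorem mul_right_mem_groupAlgebra (w : W) : linearOp (fun u => u * w) ∈ groupAlgebra W :=
  Algebra.subset_adjoin ⟨w, rfl⟩

variable (cs ha S) in
/-- The largest part of the algebra generated by the projections that is stable under left
multiplication by the projections and by the group algebra. -/
noncomputable def stablePart : Submodule ℂ (Module.End ℂ (W →₀ ℂ)) where
  carrier := {T | ∀ b ∈ projAlgebra cs ha S ⊔ groupAlgebra W, b * T ∈ projAlgebra cs ha S}
  add_mem' h1 h2 b hb := by rw [mul_add]; exact add_mem (h1 b hb) (h2 b hb)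
  zero_mem' b _ := by rw [mul_zero]; exact zero_mem _
  smul_mem' c T h b hb := by rw [mul_smul_comm]; exact Subalgebra.smul_mem _ (h b hb) c

theorem mem_projAlgebra_of_mem_stablePart {T : Module.End ℂ (W →₀ ℂ)}
    (hT : T ∈ stablePart cs ha S) : T ∈ projAlgebra cs ha S := by
  simpa using hT 1 (one_mem _)

theorem mul_mem_stablePart {b T : Module.End ℂ (W →₀ ℂ)}
    (hb : b ∈ projAlgebra cs ha S ⊔ groupAlgebra W) (hT : T ∈ stablePart cs ha S) :
    b * T ∈ stablePart cs ha S := fun c hc => by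
  rw [← mul_assoc]; exact hT _ (mul_mem hc hb)

theorem fold_mul_mem_stablePart {α : roots cs ha} (hα : α ∈ S) {T : Module.End ℂ (W →₀ ℂ)}
    (hT : T ∈ stablePart cs ha S) : linearOp (fold cs ha α) * T ∈ stablePart cs ha S :=
  mul_mem_stablePart (le_sup_left (a := projAlgebra cs ha S) (linearOp_fold_mem hα)) hT

theorem mul_right_mul_mem_stablePart (w : W) {T : Module.End ℂ (W →₀ ℂ)}
    (hT : T ∈ stablePart cs ha S) : linearOp (fun u => u * w) * T ∈ stablePart cs ha S :=
  mul_mem_stablePart (le_sup_right (a := projAlgebra cs ha S) (mul_right_mem_groupAlgebra w)) hT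

theorem mul_right_mul_mem_stablePart_iff (w : W) {T : Module.End ℂ (W →₀ ℂ)} :
    linearOp (fun u => u * w) * T ∈ stablePart cs ha S ↔ T ∈ stablePart cs ha S := by
  refine ⟨fun h => ?_, mul_right_mul_mem_stablePart w⟩
  have := mul_right_mul_mem_stablePart w⁻¹ h
  rw [← mul_assoc, linearOp_mul_right_mul] at this
  simpa [linearOp_id] using this

/-- A submodule that is stable under the generators and contained in the algebra generated by the
projections lies in the stable part. -/
theorem le_stablePart {L : Submodule ℂ (Module.End ℂ (W →₀ ℂ))}
    (hL : ∀ T ∈ L, T ∈ projAlgebra cs ha S)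
    (hfold : ∀ α ∈ S, ∀ T ∈ L, linearOp (fold cs ha α) * T ∈ L)
    (hright : ∀ w, ∀ T ∈ L, linearOp (fun u : W => u * w) * T ∈ L) : L ≤ stablePart cs ha S := by
  let stab : Subalgebra ℂ (Module.End ℂ (W →₀ ℂ)) :=
    { carrier := {b | ∀ T ∈ L, b * T ∈ L}
      mul_mem' := fun h1 h2 T hT => by rw [mul_assoc]; exact h1 _ (h2 _ hT)
      add_mem' := fun h1 h2 T hT => by rw [add_mul]; exact add_mem (h1 _ hT) (h2 _ hT)
      algebraMap_mem' := fun r T hT => by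
        rw [Algebra.algebraMap_eq_smul_one, smul_mul_assoc, one_mul]
        exact L.smul_mem r hT }
  have h : projAlgebra cs ha S ⊔ groupAlgebra W ≤ stab := by
    refine sup_le (Algebra.adjoin_le ?_) (Algebra.adjoin_le ?_)
    · rintro _ ⟨α, hα, rfl⟩
      exact hfold α hα
    · rintro _ ⟨w, rfl⟩
      exact hright w
  exact fun T hT b hb => hL _ (h hb T hT)

variable [Finite W]

/-- An element outside the stable part, with support of minimal spread. -/
structure IsMinimal (T : Module.End ℂ (W →₀ ℂ)) : Prop where
  mem : T ∈ projAlgebra cs ha S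
  notMem : T ∉ stablePart cs ha S
  le : ∀ T' ∈ projAlgebra cs ha S, T' ∉ stablePart cs ha S →
    spread cs (opSupport T) ≤ spread cs (opSupport T')

theorem IsMinimal.mul_right {T : Module.End ℂ (W →₀ ℂ)}
    (hT : IsMinimal (cs := cs) (ha := ha) (S := S) T) {w : W}
    (hw : linearOp (fun u => u * w) * T ∈ projAlgebra cs ha S) :
    IsMinimal (cs := cs) (ha := ha) (S := S) (linearOp (fun u => u * w) * T) := by
  classical
  exact ⟨hw, (mul_right_mul_mem_stablePart_iff w).not.2 hT.notMem, fun T' h1 h2 =>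
    ((spread_mono cs (opSupport_linearOp_mul _ T)).trans
      (spread_image_mul_right_le cs _ w)).trans (hT.le T' h1 h2)⟩

/-- If the support meets both sides, the fold strictly lowers its spread, so by minimality the
product falls into the stable part. -/
theorem IsMinimal.fold_mul {T : Module.End ℂ (W →₀ ℂ)}
    (hT : IsMinimal (cs := cs) (ha := ha) (S := S) T) {α : roots cs ha} (hα : α ∈ S) :
    linearOp (fold cs ha α) * T ∈ stablePart cs ha S ∨
    (∀ u ∈ opSupport T, IsPositive (geomRep cs ha u (α : B →₀ ℝ))) ∨
    (∀ u ∈ opSupport T, ¬ IsPositive (geomRep cs ha u (α : B →₀ ℝ))) := by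
  classical
  by_contra! h
  obtain ⟨h, ⟨v, hv, hv'⟩, u, hu, hu'⟩ := h
  have h1 := hT.le _ (mul_mem (linearOp_fold_mem hα) hT.mem) h
  have h2 := spread_mono cs (opSupport_linearOp_mul (fold cs ha α) T)
  have h3 := spread_image_fold_lt cs ha α hu hv hu' hv'
  omega

theorem fold_mul_of_isPositive {T : Module.End ℂ (W →₀ ℂ)} {α : roots cs ha}
    (h : ∀ u ∈ opSupport T, IsPositive (geomRep cs ha u (α : B →₀ ℝ))) :
    linearOp (fold cs ha α) * T = linearOp (fun u => u * rootReflection cs ha α) * T :=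
  linearOp_mul_congr fun u hu => fold_of_isPositive cs ha (h u hu)

theorem fold_mul_of_not_isPositive {T : Module.End ℂ (W →₀ ℂ)} {α : roots cs ha}
    (h : ∀ u ∈ opSupport T, ¬ IsPositive (geomRep cs ha u (α : B →₀ ℝ))) :
    linearOp (fold cs ha α) * T = T := by
  rw [linearOp_mul_congr (g := fun u => u) fun u hu => fold_of_not_isPositive cs ha (h u hu),
    linearOp_id, one_mul]

theorem IsMinimal.rootReflection_mul {T : Module.End ℂ (W →₀ ℂ)}
    (hT : IsMinimal (cs := cs) (ha := ha) (S := S) T) {α : roots cs ha} (hα : α ∈ S) {v : W}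
    (hv : v ∈ opSupport T) (hpos : IsPositive (geomRep cs ha v (α : B →₀ ℝ))) :
    IsMinimal (cs := cs) (ha := ha) (S := S)
      (linearOp (fun u => u * rootReflection cs ha α) * T) := by
  apply hT.mul_right
  rcases hT.fold_mul hα with h | h | h
  -- `T + s_α T = π_α T + s_α π_α T`, and both terms on the right lie in the algebra because `π_α T`
  -- is in the stable part.
  · have e : T + linearOp (fun u => u * rootReflection cs ha α) * T = linearOp (fold cs ha α) * T +
        linearOp (fun u => u * rootReflection cs ha α) * (linearOp (fold cs ha α) * T) := by
      rw [← mul_assoc, ← add_mul, linearOp_fold_add, add_mul, one_mul]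
    refine mem_of_add_mem hT.mem ?_
    rw [e]
    exact add_mem (mem_projAlgebra_of_mem_stablePart h)
      (mem_projAlgebra_of_mem_stablePart (mul_right_mul_mem_stablePart _ h))
  · rw [← fold_mul_of_isPositive h]
    exact mul_mem (linearOp_fold_mem hα) hT.mem
  · exact absurd hpos (h v hv)

/-- The translation is chosen so that `v` moves to `f v`. The image remains in the support of the
translated operator, so the next projection can be applied to it. -/
theorem IsMinimal.translate_of_mem_closure {f : Function.End W}
    (hf : f ∈ Submonoid.closure (proj cs ha '' S)) :
    ∀ {T : Module.End ℂ (W →₀ ℂ)}, IsMinimal (cs := cs) (ha := ha) (S := S) T →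
      ∀ v ∈ opSupport T,
        IsMinimal (cs := cs) (ha := ha) (S := S) (linearOp (fun u => u * (v⁻¹ * f v)) * T) := by
  induction hf using Submonoid.closure_induction with
  | mem f hf =>
    obtain ⟨α, hα, rfl⟩ := hf
    intro T hT v hv
    change IsMinimal (linearOp (fun u => u * (v⁻¹ * fold cs ha α v)) * T)
    by_cases h : IsPositive (geomRep cs ha v (α : B →₀ ℝ))
    · rw [fold_of_isPositive cs ha h, inv_mul_cancel_left]
      exact hT.rootReflection_mul hα hv h
    · rw [fold_of_not_isPositive cs ha h]
      simpa [linearOp_id] using hT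
  | one =>
    intro T hT v hv
    change IsMinimal (linearOp (fun u => u * (v⁻¹ * v)) * T)
    simpa [linearOp_id] using hT
  | mul f g _ _ ihf ihg =>
    intro T hT v hv
    change IsMinimal (linearOp (fun u => u * (v⁻¹ * f (g v))) * T)
    have h1 := ihg hT v hv
    have h2 := mul_mem_opSupport hv (v⁻¹ * g v)
    rw [mul_inv_cancel_left] at h2
    have h3 := ihf h1 _ h2
    rw [← mul_assoc, linearOp_mul_right_mul] at h3
    convert h3 using 5
    group

theorem IsMinimal.translate (hS : ProjActTransitively cs ha S) {T : Module.End ℂ (W →₀ ℂ)}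
    (hT : IsMinimal (cs := cs) (ha := ha) (S := S) T) (w : W) :
    IsMinimal (cs := cs) (ha := ha) (S := S) (linearOp (fun u => u * w) * T) := by
  obtain ⟨v, hv⟩ := opSupport_nonempty (T := T) (by
    rintro rfl; exact hT.notMem (zero_mem _))
  obtain ⟨f, hf, h⟩ := hS v (v * w)
  simpa [h] using hT.translate_of_mem_closure hf v hv

theorem not_isMinimal (hS : ProjActTransitively cs ha S) (T : Module.End ℂ (W →₀ ℂ)) :
    ¬ IsMinimal (cs := cs) (ha := ha) (S := S) T := by
  intro hT
  let X : Submodule ℂ (Module.End ℂ (W →₀ ℂ)) :=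
    Submodule.span ℂ (Set.range fun w : W => linearOp (fun u => u * w) * T)
  have hX (w : W) : linearOp (fun u => u * w) * T ∈ X := Submodule.subset_span ⟨w, rfl⟩
  -- By `le_stablePart` it is enough that the enlarged space lies in the algebra and is stable.
  -- Every translate of `T` is again minimal, so a projection sends it into the stable part, to
  -- another translate, or to itself.
  suffices h : stablePart cs ha S ⊔ X ≤ stablePart cs ha S by
    apply hT.notMem
    apply h
    have := Submodule.mem_sup_right (S := stablePart cs ha S) (hX 1)
    simpa [linearOp_id] using this
  have hmul (b : Module.End ℂ (W →₀ ℂ)) (L : Submodule ℂ (Module.End ℂ (W →₀ ℂ)))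
      (h1 : ∀ T ∈ stablePart cs ha S, b * T ∈ L)
      (h2 : ∀ w, b * (linearOp (fun u : W => u * w) * T) ∈ L) :
      ∀ T' ∈ stablePart cs ha S ⊔ X, b * T' ∈ L := by
    have : stablePart cs ha S ⊔ X ≤ L.comap (LinearMap.mulLeft ℂ b) := by
      refine sup_le h1 (Submodule.span_le.2 ?_)
      rintro _ ⟨w, rfl⟩
      exact h2 w
    exact this
  apply le_stablePart
  · intro T' hT'
    have := hmul 1 (Subalgebra.toSubmodule (projAlgebra cs ha S))
      (fun T hT => by rw [one_mul]; exact mem_projAlgebra_of_mem_stablePart hT)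
      (fun w => by rw [one_mul]; exact (hT.translate hS w).mem) T' hT'
    simpa using this
  · intro α hα
    refine hmul _ _ (fun T hT => Submodule.mem_sup_left (fold_mul_mem_stablePart hα hT))
      fun w => ?_
    rcases (hT.translate hS w).fold_mul hα with h | h | h
    · exact Submodule.mem_sup_left h
    · rw [fold_mul_of_isPositive h, ← mul_assoc, linearOp_mul_right_mul]
      exact Submodule.mem_sup_right (hX _)
    · rw [fold_mul_of_not_isPositive h]
      exact Submodule.mem_sup_right (hX _)
  · intro v
    refine hmul _ _ (fun T hT => Submodule.mem_sup_left (mul_right_mul_mem_stablePart v hT))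
      fun w => ?_
    rw [← mul_assoc, linearOp_mul_right_mul]
    exact Submodule.mem_sup_right (hX _)

theorem groupAlgebra_le_projAlgebra (hS : ProjActTransitively cs ha S) :
    groupAlgebra W ≤ projAlgebra cs ha S := by
  have h1 : (1 : Module.End ℂ (W →₀ ℂ)) ∈ stablePart cs ha S := by
    by_contra h
    let Z : Set (Module.End ℂ (W →₀ ℂ)) :=
      {T | T ∈ projAlgebra cs ha S ∧ T ∉ stablePart cs ha S}
    have hZ : Z.Nonempty := ⟨1, one_mem _, h⟩
    let φ : Module.End ℂ (W →₀ ℂ) → ℕ := fun T => spread cs (opSupport T)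
    have hmem := Function.argminOn_mem φ Z hZ
    exact not_isMinimal hS (Function.argminOn φ Z hZ)
      ⟨hmem.1, hmem.2, fun T' h1 h2 => Function.argminOn_le φ Z (show T' ∈ Z from ⟨h1, h2⟩)⟩
  intro b hb
  simpa using h1 b (le_sup_right (a := projAlgebra cs ha S) hb)

end Generation

/-! ### Recovering the `0`-Hecke generators. -/

section ZeroHecke

variable (cs : CoxeterSystem M W) {a : Matrix B B ℝ} (ha : IsCartanMatrix M a)

theorem zeroHeckeGen_of_isRightDescent {w : W} {i : B} (h : cs.IsRightDescent w i) :
    zeroHeckeGen cs i w = w := if_pos h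

theorem zeroHeckeGen_of_not_isRightDescent {w : W} {i : B} (h : ¬ cs.IsRightDescent w i) :
    zeroHeckeGen cs i w = w * cs.simple i := if_neg h

theorem exists_fold_eq_zeroHeckeGen (α : roots cs ha) :
    ∃ (v : W) (i : B), rootReflection cs ha α = v * cs.simple i * v⁻¹ ∧
      ∀ u, fold cs ha α u = zeroHeckeGen cs i (u * v) * v⁻¹ := by
  obtain ⟨v, i, h1, h2⟩ := exists_rootReflection_eq cs ha α
  refine ⟨v, i, h1, fun u => ?_⟩
  by_cases h : cs.IsRightDescent (u * v) i
  · rw [fold_of_not_isPositive cs ha (by rw [h2]; tauto),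
      zeroHeckeGen_of_isRightDescent cs h]; group
  · rw [fold_of_isPositive cs ha ((h2 u).2 h), zeroHeckeGen_of_not_isRightDescent cs h, h1]; group

theorem projAlgebra_le_heckeGroupAlgebra (S : Set (roots cs ha)) :
    projAlgebra cs ha S ≤ heckeGroupAlgebra cs := by
  refine Algebra.adjoin_le ?_
  rintro _ ⟨α, -, rfl⟩
  obtain ⟨v, i, -, h⟩ := exists_fold_eq_zeroHeckeGen cs ha α
  have e : linearOp (fold cs ha α) = linearOp (fun u => u * v⁻¹) *
      (linearOp (zeroHeckeGen cs i) * linearOp (fun u => u * v)) := by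
    rw [linearOp_mul, linearOp_mul]
    congr 1
    ext u
    exact h u
  change linearOp (fold cs ha α) ∈ heckeGroupAlgebra cs
  rw [e]
  have h1 (w : W) : linearOp (fun u => u * w) ∈ heckeGroupAlgebra cs :=
    le_sup_right (a := zeroHeckeAlgebra cs) (mul_right_mem_groupAlgebra w)
  have h2 : linearOp (zeroHeckeGen cs i) ∈ heckeGroupAlgebra cs :=
    le_sup_left (a := zeroHeckeAlgebra cs) (Algebra.subset_adjoin ⟨i, rfl⟩)
  exact mul_mem (h1 _) (mul_mem h2 (h1 _))

/-- In a Coxeter group, `s_j` and `s_k` are conjugate if `m(j, k)` is odd. -/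
theorem isConj_simple_of_odd {j k : B} (h : Odd (M j k)) :
    IsConj (cs.simple j) (cs.simple k) := by
  obtain ⟨l, hl⟩ := h
  have hpow := cs.simple_mul_simple_pow j k
  rw [hl] at hpow
  set x := cs.simple j * cs.simple k with hx
  have hj : cs.simple j * x * (cs.simple j)⁻¹ = x⁻¹ := by
    rw [hx]; simp
  have hjl : cs.simple j * (x ^ l)⁻¹ = x ^ l * cs.simple j := by
    have h := conj_pow (a := cs.simple j) (b := x) (i := l)
    rw [hj, inv_pow] at h
    rw [h, cs.inv_simple, ← mul_assoc, ← mul_assoc, cs.simple_mul_simple_self, one_mul]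
  rw [isConj_iff]
  refine ⟨x ^ l, ?_⟩
  rw [mul_assoc, hjl, ← mul_assoc, ← pow_add, ← two_mul]
  have h2 : x ^ (2 * l) = x⁻¹ := by rw [eq_inv_iff_mul_eq_one, ← pow_succ, hpow]
  rw [h2, hx, mul_inv_rev]
  simp

open scoped Classical in
/-- The sign character of the conjugacy class of a simple reflection. -/
theorem exists_sign_character (i : B) :
    ∃ χ : W →* ℤ, ∀ j, χ (cs.simple j) = if IsConj (cs.simple j) (cs.simple i) then -1 else 1 := by
  refine ⟨cs.lift ⟨fun j => if IsConj (cs.simple j) (cs.simple i) then -1 else 1, ?_⟩,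
    fun j => cs.lift_apply_simple _ j⟩
  intro j k
  dsimp only
  by_cases hj : IsConj (cs.simple j) (cs.simple i) <;>
    by_cases hk : IsConj (cs.simple k) (cs.simple i)
  · rw [if_pos hj, if_pos hk]; norm_num
  -- With different signs the relation requires `m(j, k)` even (the value `0` for `∞` included); odd
  -- `m(j, k)` would make the two reflections conjugate.
  · rcases Nat.even_or_odd (M j k) with h | h
    · rw [if_pos hj, if_neg hk, mul_one, h.neg_one_pow]
    · exact absurd ((isConj_simple_of_odd cs h).symm.trans hj) hk
  · rcases Nat.even_or_odd (M j k) with h | h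
    · rw [if_neg hj, if_pos hk, one_mul, h.neg_one_pow]
    · exact absurd ((isConj_simple_of_odd cs h).trans hk) hj
  · rw [if_neg hj, if_neg hk, one_mul, one_pow]

variable {cs ha}

/-- Otherwise the sign character of the class of `s_i` would be constant along all projections in
`S`, whereas it separates `1` from `s_i`. -/
theorem exists_isConj_rootReflection {S : Set (roots cs ha)} (hS : ProjActTransitively cs ha S)
    (i : B) : ∃ α ∈ S, IsConj (rootReflection cs ha α) (cs.simple i) := by
  classical
  by_contra! hne
  obtain ⟨χ, hχ⟩ := exists_sign_character cs i
  have hroot : ∀ α ∈ S, χ (rootReflection cs ha α) = 1 := by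
    intro α hα
    obtain ⟨v, k, h, -⟩ := exists_rootReflection_eq cs ha α
    have hk : ¬ IsConj (cs.simple k) (cs.simple i) := fun hk =>
      hne α hα (IsConj.trans (isConj_iff.2 ⟨v⁻¹, by rw [h]; group⟩) hk)
    rw [h, map_mul, map_mul, hχ, if_neg hk, mul_one, ← map_mul, mul_inv_cancel, map_one]
  obtain ⟨f, hf, h⟩ := hS 1 (cs.simple i)
  have hinv : ∀ u, χ (f u) = χ u := by
    clear h
    induction hf using Submonoid.closure_induction with
    | mem f hf =>
      obtain ⟨α, hα, rfl⟩ := hf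
      intro u
      change χ (fold cs ha α u) = χ u
      by_cases h : IsPositive (geomRep cs ha u (α : B →₀ ℝ))
      · rw [fold_of_isPositive cs ha h, map_mul, hroot α hα, mul_one]
      · rw [fold_of_not_isPositive cs ha h]
    | one => exact fun u => rfl
    | mul f g _ _ ihf ihg => exact fun u => (ihf (g u)).trans (ihg u)
  have := hinv 1
  rw [h, hχ, if_pos (IsConj.refl _), map_one] at this
  norm_num at this

/-- Conjugate simple reflections define the same sides, up to exchanging them. -/
theorem isRightDescent_mul_iff_iff [Finite W] (ha : IsCartanMatrix M a) {g : W} {i k : B}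
    (hg : g * cs.simple k * g⁻¹ = cs.simple i) (u : W) :
    (cs.IsRightDescent (u * g) k ↔ cs.IsRightDescent u i) ↔ ¬ cs.IsRightDescent g k := by
  induction u using cs.simple_induction_left with
  | one =>
    have := cs.not_isRightDescent_one i
    rw [one_mul]
    tauto
  | mul_simple_left u j ih =>
    -- Both sides flip at the same steps, since a crossing depends only on the reflection; their
    -- relation is therefore determined at `u = 1`.
    have e : cs.simple j * (u * g) = u * g * cs.simple k ↔
        cs.simple j * u = u * cs.simple i := by
      rw [← hg, ← mul_assoc, mul_assoc u g, ← mul_assoc u _ g⁻¹, eq_mul_inv_iff_mul_eq]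
    rw [mul_assoc, isRightDescent_simple_mul_iff cs ha, isRightDescent_simple_mul_iff cs ha, ne_eq,
      ne_eq, e]
    tauto

theorem linearOp_zeroHeckeGen_mem_projAlgebra [Finite W] {S : Set (roots cs ha)}
    (hS : ProjActTransitively cs ha S) (i : B) :
    linearOp (zeroHeckeGen cs i) ∈ projAlgebra cs ha S := by
  have hR (w : W) : linearOp (fun u => u * w) ∈ projAlgebra cs ha S :=
    groupAlgebra_le_projAlgebra hS (mul_right_mem_groupAlgebra w)
  obtain ⟨α, hα, hconj⟩ := exists_isConj_rootReflection hS i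
  obtain ⟨v, k, h1, h2⟩ := exists_fold_eq_zeroHeckeGen cs ha α
  obtain ⟨c, hc⟩ := isConj_iff.1 hconj
  have hg : (c * v) * cs.simple k * (c * v)⁻¹ = cs.simple i := by rw [← hc, h1]; group
  set g := c * v with hgdef
  -- Conjugation by `c` turns `π_α` into the projection for the root `g(α_k)`, whose reflection is
  -- `s_i`.
  have hF : linearOp (fun u => zeroHeckeGen cs k (u * g) * g⁻¹) ∈ projAlgebra cs ha S := by
    have e : linearOp (fun u => zeroHeckeGen cs k (u * g) * g⁻¹) =
        linearOp (fun u => u * c⁻¹) * (linearOp (fold cs ha α) * linearOp (fun u => u * c)) := by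
      rw [linearOp_mul, linearOp_mul]
      congr 1
      ext u
      simp [h2, hgdef, mul_assoc]
    rw [e]
    exact mul_mem (hR _) (mul_mem (linearOp_fold_mem hα) (hR _))
  have hrefl (u : W) : u * g * cs.simple k * g⁻¹ = u * cs.simple i := by rw [← hg]; group
  have hside := isRightDescent_mul_iff_iff ha hg
  by_cases h : cs.IsRightDescent g k
  -- Here `g(α_k)` is negative: the projection goes to the opposite side and equals `1 + s_i - π_i`.
  · have e : linearOp (fun u => zeroHeckeGen cs k (u * g) * g⁻¹) + linearOp (zeroHeckeGen cs i) =
        1 + linearOp (fun u => u * cs.simple i) := by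
      ext u : 2
      have := hside u
      simp only [LinearMap.coe_comp, Function.comp_apply, Finsupp.lsingle_apply,
        LinearMap.add_apply, linearOp_single, Module.End.one_apply]
      by_cases h' : cs.IsRightDescent u i
      · rw [zeroHeckeGen_of_isRightDescent cs h',
          zeroHeckeGen_of_not_isRightDescent cs (w := u * g) (by tauto),
          hrefl, add_comm]
      · rw [zeroHeckeGen_of_not_isRightDescent cs h',
          zeroHeckeGen_of_isRightDescent cs (w := u * g) (by tauto),
          mul_inv_cancel_right]
    refine mem_of_add_mem hF ?_
    rw [e]
    exact add_mem (one_mem (projAlgebra cs ha S)) (hR _)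
  · convert hF using 2
    ext u
    have := hside u
    by_cases h' : cs.IsRightDescent u i
    · rw [zeroHeckeGen_of_isRightDescent cs h',
          zeroHeckeGen_of_isRightDescent cs (w := u * g) (by tauto),
          mul_inv_cancel_right]
    · rw [zeroHeckeGen_of_not_isRightDescent cs h',
          zeroHeckeGen_of_not_isRightDescent cs (w := u * g) (by tauto),
          hrefl]

theorem projAlgebra_eq_heckeGroupAlgebra [Finite W] {S : Set (roots cs ha)}
    (hS : ProjActTransitively cs ha S) : projAlgebra cs ha S = heckeGroupAlgebra cs := by
  refine le_antisymm (projAlgebra_le_heckeGroupAlgebra cs ha S)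
    (sup_le (Algebra.adjoin_le ?_) (groupAlgebra_le_projAlgebra hS))
  rintro _ ⟨i, rfl⟩
  exact linearOp_zeroHeckeGen_mem_projAlgebra hS i

end ZeroHecke

end HeckeGroup

theorem mainTheorem6 {B W : Type*} [Group W] [Finite W] {M : CoxeterMatrix B}
    (cs : CoxeterSystem M W) {a : Matrix B B ℝ} (ha : HeckeGroup.IsCartanMatrix M a)
    (S : Set (HeckeGroup.roots cs ha)) (hS : HeckeGroup.ProjActTransitively cs ha S) :
    Algebra.adjoin ℂ ((fun α => HeckeGroup.linearOp (HeckeGroup.proj cs ha α)) '' S) =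
      HeckeGroup.heckeGroupAlgebra cs :=
  HeckeGroup.projAlgebra_eq_heckeGroupAlgebra hS
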